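/- For positive integers $n,k$ let $\mathrm{Dis}(n)$ be the set of partitions of $n$ into distinct positive parts (written in decreasing order), partially ordered by majorization: for $\alpha=(\alpha_1,\dots,\alpha_s)$ and $\beta=(\beta_1,\dots,\beta_t)$ in $\mathrm{Dis}(n)$, $\beta\succeq\alpha$ if $\sum_{i\le j}\beta_i\ge\sum_{i\le j}\alpha_i$ for all $j\le\min\{s,t\}$. Let $\mathrm{Dis}_k(n)$ be the set of those with exactly $k$ parts. An $S$-block is a pair $[\alpha|\beta]$ with $\alpha,\beta\in\mathrm{Dis}(n)$, $\beta\succeq\alpha$, and $\mathrm{len}(\alpha)\in\{\mathrm{len}(\beta),\mathrm{len}(\beta)+1\}$. The set $S\text{-}Block(n)$ of these blocks is partially ordered by: $[\alpha_1|\beta_1]$ majorizes $[\alpha_2|\beta_2]$ if $\alpha_1\succeq\alpha_2$ and $\beta_1\preceq\beta_2$. For a partition $\pi$ with Ferrers diagram $F(\pi)$, $\alpha(\pi)$ is the partition whose parts are the nonzero numbers of boxes in the rows of $F(\pi)$ on and to the right of the main diagonal, and $\beta(\pi)$ is the partition whose parts are the nonzero numbers of boxes in the columns of $F(\pi)$ strictly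 below the main diagonal. A finite graph $G$ is an NG-graph if $\chi(G)+\chi(\overline G)=|V(G)|+1$; with $A_G=\{v:\deg(v)=\chi(G)-1\}$, an NG-graph $G$ is NG-1 if $A_G$ induces a clique, and NG-2 if $A_G$ induces a stable set. For $i\in\{1,2\}$, an $S$-block $[\alpha|\beta]$ is NG-$i$ if there is an NG-$i$ graph without isolated vertices whose degree sequence $\pi$ satisfies $\alpha(\pi)=\alpha$ and $\beta(\pi)=\beta$. For $n\ge\binom{k+1}{2}$ and $i\in\{1,2\}$, let $NG_i(n,k)$ be the set of NG-$i$ $S$-blocks $[\alpha|\beta]$ with $\alpha,\beta\in\mathrm{Dis}_k(n)$. Let $\tau'_k(n)=(n-\binom k2,k-1,k-2,\dots,2,1)$. Writing $n-\binom{k+1}{2}=qk+r$ with $0\le r<k$, let $\tau_k(n)$ be the partition with parts $s_j+(k+1-j)$, $1\le j\le k$, where $s_j=q+1$ for $j\le r$ and $s_j=q$ for $j>r$. A subset $P'$ of a poset $P$ is an amphora if there are a (possibly empty) antichain $A$ in $P$ and an element $x\in P$ with $x\le a$ for all $a\in A$ such that $P'$ is the set of all $p\in P$ with $x\le p$ and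 $p\le a$ for some $a\in A$. **Theorem.** Let $n,k$ be positive integers with $n\ge\binom{k+1}{2}$. Then $[\tau_k(n)|\tau'_k(n)]$ is an $S$-block, and for each $i\in\{1,2\}$ the set $NG_i(n,k)$ is an amphora in $S\text{-}Block(n)$; it consists exactly of those $S$-blocks that majorize $[\tau_k(n)|\tau'_k(n)]$ and are majorized by some NG-$i$ block $[\gamma|\gamma]$ with $\gamma\in\mathrm{Dis}_k(n)$. -/

import Mathlib

/-! ### Partitions into distinct parts, and majorization -/

/-- `Dis(n)`: partitions of `n` into distinct positive parts. -/
@[ext]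
structure DisPartition (n : ℕ) extends Nat.Partition n where
  nodup : parts.Nodup

namespace DisPartition

variable {n : ℕ}

/-- The number of parts. -/
def len (p : DisPartition n) : ℕ := p.parts.card

/-- The parts listed in decreasing order. -/
def sortedParts (p : DisPartition n) : List ℕ := p.parts.sort (· ≥ ·)

/-- The sum of the `j` largest parts (of all parts, if there are fewer than `j`). -/
def prefixSum (p : DisPartition n) (j : ℕ) : ℕ := (p.sortedParts.take j).sum

/-- `p ⪯ q` for two partitions of the same `n`: `q` majorizes `p`. -/
def MajorizedBy (p q : DisPartition n) : Prop :=
  ∀ j ≤ min p.len q.len, p.prefixSum j ≤ q.prefixSum j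

theorem length_sortedParts (p : DisPartition n) : p.sortedParts.length = p.len := by
  simp [sortedParts, len]

theorem sum_sortedParts (p : DisPartition n) : p.sortedParts.sum = n := by
  rw [← Multiset.sum_coe, sortedParts, Multiset.sort_eq, p.parts_sum]

theorem prefixSum_le (p : DisPartition n) (j : ℕ) : p.prefixSum j ≤ n := by
  have h := List.sum_take_add_sum_drop p.sortedParts j
  rw [sum_sortedParts] at h
  unfold prefixSum
  omega

theorem prefixSum_mono (p : DisPartition n) {i j : ℕ} (h : i ≤ j) :
    p.prefixSum i ≤ p.prefixSum j :=
  (List.take_sublist_take_left h).sum_le_sum (by simp)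

theorem prefixSum_of_len_le (p : DisPartition n) {j : ℕ} (h : p.len ≤ j) :
    p.prefixSum j = n := by
  rw [prefixSum, List.take_of_length_le (by rwa [length_sortedParts]), sum_sortedParts]

/-- For partitions of the same integer the bound on `j` may be dropped. -/
theorem majorizedBy_iff (p q : DisPartition n) :
    p.MajorizedBy q ↔ ∀ j, p.prefixSum j ≤ q.prefixSum j := by
  refine ⟨fun h j => ?_, fun h j _ => h j⟩
  by_cases hq : q.len ≤ j
  · rw [q.prefixSum_of_len_le hq]
    exact p.prefixSum_le j
  by_cases hp : p.len ≤ j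
  · have h1 := h p.len (by simp; omega)
    rw [p.prefixSum_of_len_le le_rfl] at h1
    exact (p.prefixSum_le j).trans (h1.trans (q.prefixSum_mono hp))
  · exact h j (by simp; omega)

theorem eq_of_prefixSum_eq {p q : DisPartition n} (h : ∀ j, p.prefixSum j = q.prefixSum j) :
    p = q := by
  have key : ∀ (a b : List ℕ), (∀ x ∈ a, 0 < x) → (∀ x ∈ b, 0 < x) →
      (∀ j, (a.take j).sum = (b.take j).sum) → a = b := by
    intro a
    induction a with
    | nil =>
      intro b _ hb hs
      cases b with
      | nil => rfl
      | cons y b =>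
        have h1 := hs 1
        have h2 := hb y (by simp)
        simp at h1
        omega
    | cons x a ih =>
      intro b ha hb hs
      cases b with
      | nil =>
        have h1 := hs 1
        have h2 := ha x (by simp)
        simp at h1
        omega
      | cons y b =>
        have h1 : x = y := by simpa using hs 1
        subst h1
        rw [ih b (fun z hz => ha z (by simp [hz])) (fun z hz => hb z (by simp [hz]))]
        intro j
        simpa using hs (j + 1)
  have hpos : ∀ r : DisPartition n, ∀ x ∈ r.sortedParts, 0 < x := fun r x hx =>
    r.parts_pos (by simpa [sortedParts] using hx)
  have hl : p.sortedParts = q.sortedParts := key _ _ (hpos p) (hpos q) h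
  have hm : p.parts = q.parts := by
    rw [← Multiset.sort_eq p.parts (· ≥ ·), ← Multiset.sort_eq q.parts (· ≥ ·)]
    exact congrArg _ hl
  exact DisPartition.ext hm

/-- `Dis(n)` is ordered by majorization. -/
instance : PartialOrder (DisPartition n) where
  le := MajorizedBy
  le_refl p := fun _ _ => le_rfl
  le_trans p q r hpq hqr := by
    rw [majorizedBy_iff] at *
    exact fun j => (hpq j).trans (hqr j)
  le_antisymm p q hpq hqp := by
    rw [majorizedBy_iff] at *
    exact eq_of_prefixSum_eq fun j => le_antisymm (hpq j) (hqp j)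

theorem sum_range_sub (k : ℕ) : ∑ i ∈ Finset.range k, (k - i) = (k + 1).choose 2 := by
  induction k with
  | zero => rfl
  | succ k ih =>
    rw [Finset.sum_range_succ', Nat.choose_succ_succ' (k + 1) 1, ← ih]
    simp
    omega

/-- `τ_k(n)`: writing `n - (k+1 choose 2) = q * k + r` with `0 ≤ r < k`, the parts are
`s_i + (k + 1 - i)` for `i = 1, …, k`, with `s_i = q + 1` for `i ≤ r` and `s_i = q` for `i > r`.
In the code the index `i` is shifted by one, so that it runs over `0, …, k - 1`. -/
def tauMin (n k : ℕ) (hk : 1 ≤ k) (h : (k + 1).choose 2 ≤ n) : DisPartition n where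
  parts := (Multiset.range k).map fun i =>
    (if i < (n - (k + 1).choose 2) % k then (n - (k + 1).choose 2) / k + 1
      else (n - (k + 1).choose 2) / k) + (k - i)
  parts_pos := by
    intro x hx
    obtain ⟨i, hi, rfl⟩ := Multiset.mem_map.1 hx
    rw [Multiset.mem_range] at hi
    omega
  parts_sum := by
    have h1 := Nat.div_add_mod (n - (k + 1).choose 2) k
    have h2 : (n - (k + 1).choose 2) % k < k := Nat.mod_lt _ hk
    set q := (n - (k + 1).choose 2) / k
    set r := (n - (k + 1).choose 2) % k
    change ∑ i ∈ Finset.range k, ((if i < r then q + 1 else q) + (k - i)) = n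
    have h3 : ∀ i, (if i < r then q + 1 else q) = q + (if i < r then 1 else 0) := by
      intro i
      split_ifs <;> rfl
    have h4 : (Finset.range k).filter (fun i => i < r) = Finset.range r := by
      ext i
      simp only [Finset.mem_filter, Finset.mem_range]
      omega
    simp only [h3, Finset.sum_add_distrib, sum_range_sub, Finset.sum_const, Finset.card_range,
      smul_eq_mul, ← Finset.sum_filter, h4]
    omega
  nodup := by
    refine Multiset.Nodup.map_on ?_ (Multiset.nodup_range k)
    intro i hi j hj hij
    rw [Multiset.mem_range] at hi hj
    split_ifs at hij <;> omega

/-- `τ'_k(n) = (n - (k choose 2), k - 1, k - 2, …, 2, 1)`. -/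
def tauMax (n k : ℕ) (hk : 1 ≤ k) (h : (k + 1).choose 2 ≤ n) : DisPartition n where
  parts := (n - k.choose 2) ::ₘ (Finset.Icc 1 (k - 1)).val
  parts_pos := by
    have h1 : (k + 1).choose 2 = k + k.choose 2 := by simp [Nat.choose_succ_succ' k 1]
    intro x hx
    rw [Multiset.mem_cons, Finset.mem_val, Finset.mem_Icc] at hx
    omega
  parts_sum := by
    have h1 : (k + 1).choose 2 = k + k.choose 2 := by simp [Nat.choose_succ_succ' k 1]
    have h2 : (Finset.Icc 1 (k - 1)).val.sum = k.choose 2 := by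
      obtain ⟨m, rfl⟩ : ∃ m, k = m + 1 := ⟨k - 1, by omega⟩
      rw [Nat.add_sub_cancel, Finset.sum_val]
      clear h h1 hk
      induction m with
      | zero => rfl
      | succ m ih =>
        rw [Finset.sum_Icc_succ_top (by omega), ih, Nat.choose_succ_succ' (m + 1) 1]
        simp
        omega
    rw [Multiset.sum_cons, h2]
    omega
  nodup := by
    have h1 : (k + 1).choose 2 = k + k.choose 2 := by simp [Nat.choose_succ_succ' k 1]
    refine Multiset.nodup_cons.2 ⟨?_, Finset.nodup _⟩
    rw [Finset.mem_val, Finset.mem_Icc]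
    omega

end DisPartition

/-! ### Split blocks -/

/-- An `S`-block `[α|β]` of partitions of the same `n` into distinct parts. -/
@[ext]
structure SBlock (n : ℕ) where
  α : DisPartition n
  β : DisPartition n
  maj : α ≤ β
  len_eq : α.len = β.len ∨ α.len = β.len + 1

/-- Majorization of blocks: `[α₁|β₁] ⪰ [α₂|β₂]` when `α₁ ⪰ α₂` and `β₁ ⪯ β₂`. -/
instance (n : ℕ) : PartialOrder (SBlock n) where
  le a b := a.α ≤ b.α ∧ b.β ≤ a.β
  le_refl a := ⟨le_rfl, le_rfl⟩
  le_trans a b c hab hbc := ⟨hab.1.trans hbc.1, hbc.2.trans hab.2⟩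
  le_antisymm a b hab hba := SBlock.ext (le_antisymm hab.1 hba.1) (le_antisymm hba.2 hab.2)

/-- Amphoras in a poset (the antichain may be empty, and then so is the amphora). -/
def IsAmphora {P : Type*} [PartialOrder P] (S : Set P) : Prop :=
  ∃ (A : Set P) (x : P), IsAntichain (· ≤ ·) A ∧ (∀ a ∈ A, x ≤ a) ∧
    S = {p | x ≤ p ∧ ∃ a ∈ A, p ≤ a}

/-! ### Ferrers diagrams -/

/-- The parts of `α(π)`, where `F` is the Ferrers diagram of `π`: the nonzero numbers of boxes in
the rows of `F` on and to the right of the main diagonal. Boxes are pairs (row, column). -/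
def alphaParts (F : YoungDiagram) : Multiset ℕ :=
  ((Multiset.range (F.colLen 0)).map fun i => ((F.row i).filter fun c => c.1 ≤ c.2).card).filter
    (0 < ·)

/-- The parts of `β(π)`, where `F` is the Ferrers diagram of `π`: the nonzero numbers of boxes in
the columns of `F` strictly below the main diagonal. -/
def betaParts (F : YoungDiagram) : Multiset ℕ :=
  ((Multiset.range (F.rowLen 0)).map fun j => ((F.col j).filter fun c => c.2 < c.1).card).filter
    (0 < ·)

/-! ### Nordhaus-Gaddum graphs -/

section Graphs

open Classical in
/-- `F` is the Ferrers diagram of the degree sequence of `G`. Row lengths of a Young diagram are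
positive, so this includes that `G` has no isolated vertices. -/
def IsDegreeDiagram {V : Type*} [Fintype V] (G : SimpleGraph V) (F : YoungDiagram) : Prop :=
  (F.rowLens : Multiset ℕ) = Finset.univ.val.map fun v => G.degree v

/-- Nordhaus-Gaddum graphs: `χ(G) + χ(Gᶜ) = |V(G)| + 1`. -/
def IsNGGraph {V : Type*} [Fintype V] (G : SimpleGraph V) : Prop :=
  G.chromaticNumber + Gᶜ.chromaticNumber = (Fintype.card V : ℕ∞) + 1

open Classical in
/-- The set `A_G` of vertices of degree `χ(G) - 1`. -/
def setA {V : Type*} [Fintype V] (G : SimpleGraph V) : Set V :=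
  {v | (G.degree v : ℕ∞) + 1 = G.chromaticNumber}

/-- NG-1 graphs: NG-graphs in which `A_G` induces a clique. -/
def IsNG1Graph {V : Type*} [Fintype V] (G : SimpleGraph V) : Prop :=
  IsNGGraph G ∧ G.IsClique (setA G)

/-- NG-2 graphs: NG-graphs in which `A_G` induces a stable set. -/
def IsNG2Graph {V : Type*} [Fintype V] (G : SimpleGraph V) : Prop :=
  IsNGGraph G ∧ G.IsIndepSet (setA G)

end Graphs

namespace SBlock

variable {n : ℕ}

/-- `[α|β] = [α(π)|β(π)]` for the degree sequence `π` of `G`. -/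
def IsBlockOf {V : Type*} [Fintype V] (b : SBlock n) (G : SimpleGraph V) : Prop :=
  ∃ F : YoungDiagram, IsDegreeDiagram G F ∧ alphaParts F = b.α.parts ∧ betaParts F = b.β.parts

/-- NG-1 `S`-blocks: those that come from an NG-1 graph. -/
def IsNG1 (b : SBlock n) : Prop :=
  ∃ (r : ℕ) (G : SimpleGraph (Fin r)), IsNG1Graph G ∧ b.IsBlockOf G

/-- NG-2 `S`-blocks: those that come from an NG-2 graph. -/
def IsNG2 (b : SBlock n) : Prop :=
  ∃ (r : ℕ) (G : SimpleGraph (Fin r)), IsNG2Graph G ∧ b.IsBlockOf G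

/-- `A(n,k)`: the `S`-blocks `[α|β]` with `α, β ∈ Dis_k(n)`. -/
def amphoraA (n k : ℕ) : Set (SBlock n) := {b | b.α.len = k ∧ b.β.len = k}

/-- `NG_1(n,k)`: the NG-1 elements of `A(n,k)`. -/
def NG1 (n k : ℕ) : Set (SBlock n) := {b | b ∈ amphoraA n k ∧ b.IsNG1}

/-- `NG_2(n,k)`: the NG-2 elements of `A(n,k)`. -/
def NG2 (n k : ℕ) : Set (SBlock n) := {b | b ∈ amphoraA n k ∧ b.IsNG2}

/-- The block `[γ|γ]`. -/
def diag (γ : DisPartition n) : SBlock n := ⟨γ, γ, le_rfl, Or.inl rfl⟩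

/-- `(Max)^n_k`: the blocks `[γ|γ]` with `γ ∈ Dis_k(n)`. -/
def maxBlocks (n k : ℕ) : Set (SBlock n) := {m | ∃ γ : DisPartition n, γ.len = k ∧ m = diag γ}

end SBlock

/-! ### Parts in decreasing order -/

/-! For a block with `k` parts on both sides, being NG-1 or NG-2 depends on one smallest part only.

Let the degree diagram `F` have `α(F) = p` and `β(F) = q`, both with `k` parts and sum `n`. Counting
the boxes in the first `k` rows and in the first `k` columns gives equality in the Erdős–Gallai
inequality at `k` (`sum_rowLen_add`). So in every realization the `k` vertices of largest degree
form a clique and the others a stable set. Row `k` (counting from 0) has length exactly `k`, so its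
vertex is joined to the whole clique. Hence a clique of size `k + 1` and a stable set of size `N -
k` share one vertex and cover the graph. The chromatic numbers are `k + 1` and `N - k`, the graph is
NG, and `A_G` consists of the vertices of degree `k`. It contains a second stable vertex iff the
smallest part of `q` exceeds 1, and a vertex of the `k`-clique iff the smallest part of `p` is 1. So
NG-1 means that `β` ends in 1, and NG-2 that `α` ends in at least 2 (`isNG1_iff`, `isNG2_iff`).
Conversely `p ≤ q` is the Gale–Ryser condition for the edges between clique and stable set, so every
such block comes from a graph.

The rest is order theory. At fixed length, the smallest part weakly decreases as a partition goes up
in majorization (`last_part_le`), so both conditions pass to smaller blocks. An NG-1 block lies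
below `[β|β]`, an NG-2 block below `[α|α]`, and each of these diagonal blocks is again of the same
type. -/

theorem Finset.sum_range_le_sum_range_of_tail {f g : ℕ → ℕ} {j k : ℕ} (hj : j ≤ k)
    (hsum : ∑ i ∈ Finset.range k, f i = ∑ i ∈ Finset.range k, g i)
    (h : ∀ i, j ≤ i → i < k → g i ≤ f i) :
    ∑ i ∈ Finset.range j, f i ≤ ∑ i ∈ Finset.range j, g i := by
  rw [← Finset.sum_range_add_sum_Ico f hj, ← Finset.sum_range_add_sum_Ico g hj] at hsum
  have : ∑ i ∈ Finset.Ico j k, g i ≤ ∑ i ∈ Finset.Ico j k, f i :=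
    Finset.sum_le_sum fun i hi => h i (Finset.mem_Ico.1 hi).1 (Finset.mem_Ico.1 hi).2
  omega

namespace DisPartition

variable {n : ℕ}

/-- The part with index `i`, in decreasing order and counting from `0`; it is `0` for `i` at least
the number of parts. -/
def part (p : DisPartition n) (i : ℕ) : ℕ := p.sortedParts.getD i 0

theorem part_of_lt (p : DisPartition n) {i : ℕ} (hi : i < p.sortedParts.length) :
    p.part i = p.sortedParts[i] := by
  simp [part, hi]

theorem part_of_len_le (p : DisPartition n) {i : ℕ} (hi : p.len ≤ i) : p.part i = 0 := by
  rw [← length_sortedParts] at hi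
  simp [part, hi]

theorem part_pos (p : DisPartition n) {i : ℕ} (hi : i < p.len) : 0 < p.part i := by
  rw [← length_sortedParts] at hi
  rw [part_of_lt p hi]
  refine p.parts_pos (?_ : _ ∈ p.parts)
  rw [← Multiset.mem_sort (r := (· ≥ ·))]
  exact List.getElem_mem hi

theorem coe_sortedParts (p : DisPartition n) : (p.sortedParts : Multiset ℕ) = p.parts :=
  Multiset.sort_eq _ _

theorem pairwise_sortedParts (p : DisPartition n) : p.sortedParts.Pairwise (· > ·) := by
  have h1 : p.sortedParts.Pairwise (· ≥ ·) := Multiset.pairwise_sort _ _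
  have h2 : p.sortedParts.Nodup := by
    rw [← Multiset.coe_nodup, coe_sortedParts]
    exact p.nodup
  exact (h1.and h2).imp fun h => lt_of_le_of_ne h.1 (Ne.symm h.2)

theorem part_lt_part (p : DisPartition n) {i j : ℕ} (hij : i < j) (hj : j < p.len) :
    p.part j < p.part i := by
  rw [← length_sortedParts] at hj
  rw [part_of_lt p hj, part_of_lt p (hij.trans hj)]
  exact List.pairwise_iff_getElem.1 p.pairwise_sortedParts i j _ _ hij

theorem part_add_le_part (p : DisPartition n) {i j : ℕ} (hij : i ≤ j) (hj : j < p.len) :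
    p.part j + (j - i) ≤ p.part i := by
  induction j, hij using Nat.le_induction with
  | base => simp
  | succ j hij ih =>
    have h1 := ih (by omega)
    have h2 := p.part_lt_part (Nat.lt_add_one j) hj
    omega

theorem len_sub_le_part (p : DisPartition n) (i : ℕ) : p.len - i ≤ p.part i := by
  by_cases hi : i < p.len
  · have h1 := p.part_add_le_part (i := i) (j := p.len - 1) (by omega) (by omega)
    have h2 := p.part_pos (i := p.len - 1) (by omega)
    omega
  · omega

theorem prefixSum_eq_sum (p : DisPartition n) (j : ℕ) :
    p.prefixSum j = ∑ i ∈ Finset.range j, p.part i := by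
  have key : ∀ (l : List ℕ) (j : ℕ), (l.take j).sum = ∑ i ∈ Finset.range j, l.getD i 0 := by
    intro l
    induction l with
    | nil => simp
    | cons a l ih =>
      intro j
      cases j with
      | zero => simp
      | succ j =>
        rw [Finset.sum_range_succ']
        simp [ih j, add_comm]
  exact key _ _

theorem sum_part (p : DisPartition n) {k : ℕ} (h : p.len ≤ k) :
    ∑ i ∈ Finset.range k, p.part i = n := by
  rw [← prefixSum_eq_sum, prefixSum_of_len_le p h]

theorem le_iff_sum_part (p q : DisPartition n) :
    p ≤ q ↔ ∀ j, ∑ i ∈ Finset.range j, p.part i ≤ ∑ i ∈ Finset.range j, q.part i := by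
  simp only [← prefixSum_eq_sum]
  exact majorizedBy_iff p q

/-- The prefix sums of `p` reach `n` at `p.len`, hence so do those of `q`; one more positive part of
`q` would overshoot `n`. -/
theorem len_le_of_le {p q : DisPartition n} (h : p ≤ q) : q.len ≤ p.len := by
  by_contra! hlt
  have h1 := (le_iff_sum_part p q).1 h p.len
  rw [sum_part p le_rfl] at h1
  have h2 := sum_part q le_rfl
  have h3 := (le_iff_sum_part p q).1 h (p.len + 1)
  have h4 := q.part_pos hlt
  have h5 := q.prefixSum_le (p.len + 1)
  rw [prefixSum_eq_sum, Finset.sum_range_succ] at h5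
  omega

theorem le_of_len_eq {p q : DisPartition n} {k : ℕ} (hp : p.len = k) (hq : q.len = k)
    (h : ∀ j, 1 ≤ j → j ≤ k →
      ∑ i ∈ Finset.range j, p.part i ≤ ∑ i ∈ Finset.range j, q.part i) : p ≤ q := by
  intro j hj
  rw [prefixSum_eq_sum, prefixSum_eq_sum]
  rcases Nat.eq_zero_or_pos j with rfl | h0
  · simp
  · exact h j h0 (by omega)

/-- If `p ≤ q` have the same length, then the smallest part of `q` is at most that of `p`. -/
theorem last_part_le {p q : DisPartition n} {k : ℕ} (hp : p.len = k + 1) (hq : q.len = k + 1)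
    (h : p ≤ q) : q.part k ≤ p.part k := by
  have h1 := sum_part p hp.le
  have h2 := sum_part q hq.le
  have h3 := (le_iff_sum_part p q).1 h k
  rw [Finset.sum_range_succ] at h1 h2
  omega

/-- A strictly decreasing enumeration of the parts is the list of parts in decreasing order. -/
theorem part_eq_of_parts_eq_map (p : DisPartition n) {k : ℕ} {f : ℕ → ℕ}
    (hf : ∀ i j, i < j → j < k → f j < f i) (h : p.parts = (Multiset.range k).map f) :
    p.len = k ∧ ∀ i < k, p.part i = f i := by
  have h1 : p.sortedParts = (List.range k).map f := by
    refine List.Perm.eq_of_pairwise (le := (· > ·)) (fun a b _ _ h1 h2 => ?_)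
      p.pairwise_sortedParts ?_ ?_
    · exact absurd h1 (lt_asymm h2)
    · rw [List.pairwise_map]
      rw [List.pairwise_iff_getElem]
      intro i j hi hj hij
      simp only [List.getElem_range]
      exact hf i j hij (by simpa using hj)
    · rw [← Multiset.coe_eq_coe, coe_sortedParts, h]
      rfl
  have h2 : p.len = k := by rw [len, h]; simp
  refine ⟨h2, fun i hi => ?_⟩
  rw [part_of_lt p (by rw [length_sortedParts]; omega)]
  simp [h1]

theorem parts_eq_map_part (p : DisPartition n) :
    p.parts = (Multiset.range p.len).map p.part := by
  rw [← coe_sortedParts, ← Multiset.coe_range, Multiset.map_coe, Multiset.coe_eq_coe]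
  refine List.Perm.of_eq (List.ext_getElem (by simp [length_sortedParts]) fun i h1 h2 => ?_)
  rw [List.getElem_map, List.getElem_range, part_of_lt]

theorem filter_pos_map_range {f : ℕ → ℕ} {k N : ℕ} (hk : k ≤ N) (h1 : ∀ i < k, 0 < f i)
    (h2 : ∀ i, k ≤ i → f i = 0) :
    ((Multiset.range N).map f).filter (0 < ·) = (Multiset.range k).map f := by
  induction N, hk using Nat.le_induction with
  | base =>
    refine Multiset.filter_eq_self.2 fun a ha => ?_
    obtain ⟨i, hi, rfl⟩ := Multiset.mem_map.1 ha
    exact h1 i (Multiset.mem_range.1 hi)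
  | succ N hN ih =>
    rw [Multiset.range_succ, Multiset.map_cons, Multiset.filter_cons_of_neg _ (by simp [h2 N hN]),
      ih]

/-- The nonzero values of a function that decreases strictly while it is positive are the parts
of `p` exactly when its values are the parts of `p` in decreasing order. -/
theorem filter_pos_map_range_eq_parts_iff (p : DisPartition n) {f : ℕ → ℕ} {N : ℕ}
    (hf : ∀ i, f (i + 1) ≤ f i - 1) (hN : f N = 0) :
    ((Multiset.range N).map f).filter (0 < ·) = p.parts ↔ ∀ i, p.part i = f i := by
  have hanti : ∀ i j, i < j → f j ≤ f i - 1 := by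
    intro i j hij
    induction j, hij using Nat.le_induction with
    | base => exact hf i
    | succ j _ ih => have := hf j; omega
  constructor
  · intro h
    -- Subtraction is truncated: `f` decreases strictly up to its first zero and vanishes from there
    -- on, so this zero marks the number of parts.
    have hex : ∃ i, f i = 0 := ⟨N, hN⟩
    have h1 : ∀ i < Nat.find hex, 0 < f i := fun i hi => Nat.pos_of_ne_zero (Nat.find_min hex hi)
    have h2 : ∀ i, Nat.find hex ≤ i → f i = 0 := by
      intro i hi
      rcases hi.eq_or_lt with rfl | hi
      · exact Nat.find_spec hex
      · have h3 := hanti _ _ hi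
        have h4 := Nat.find_spec hex
        omega
    rw [filter_pos_map_range (Nat.find_min' hex hN) h1 h2] at h
    obtain ⟨h3, h4⟩ := p.part_eq_of_parts_eq_map
      (fun i j hij hj => by have := hanti i j hij; have := h1 j hj; omega) h.symm
    intro i
    by_cases hi : i < Nat.find hex
    · exact h4 i hi
    · rw [h2 i (by omega), part_of_len_le p (by omega)]
  · intro h
    have hlen : p.len ≤ N := by
      by_contra! hlt
      have := p.part_pos hlt
      rw [h] at this
      omega
    rw [filter_pos_map_range hlen (fun i hi => h i ▸ p.part_pos hi)
      (fun i hi => h i ▸ p.part_of_len_le hi), p.parts_eq_map_part]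
    exact Multiset.map_congr rfl fun i _ => (h i).symm

/-! ### The extreme partitions with `k` parts -/

variable {k : ℕ}

theorem tauMin_part (hk : 1 ≤ k) (hn : (k + 1).choose 2 ≤ n) :
    (tauMin n k hk hn).len = k ∧ ∀ i < k, (tauMin n k hk hn).part i =
      (if i < (n - (k + 1).choose 2) % k then (n - (k + 1).choose 2) / k + 1
        else (n - (k + 1).choose 2) / k) + (k - i) := by
  refine part_eq_of_parts_eq_map _ (fun i j hij hj => ?_) rfl
  split_ifs <;> omega

theorem tauMax_part (hk : 1 ≤ k) (hn : (k + 1).choose 2 ≤ n) :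
    (tauMax n k hk hn).len = k ∧ ∀ i < k, (tauMax n k hk hn).part i =
      if i = 0 then n - k.choose 2 else k - i := by
  have h1 : (k + 1).choose 2 = k + k.choose 2 := by simp [Nat.choose_succ_succ' k 1]
  have hf : ∀ i j, i < j → j < k →
      (if j = 0 then n - k.choose 2 else k - j) < (if i = 0 then n - k.choose 2 else k - i) := by
    intro i j hij hj
    split_ifs <;> omega
  refine part_eq_of_parts_eq_map _ hf ?_
  refine (Multiset.Nodup.ext (tauMax n k hk hn).nodup
    (Multiset.Nodup.map_on ?_ (Multiset.nodup_range k))).2 fun x => ?_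
  · intro i hi j hj hij
    rw [Multiset.mem_range] at hi hj
    rcases lt_trichotomy i j with h | h | h
    · have := hf i j h hj; omega
    · exact h
    · have := hf j i h hi; omega
  · change x ∈ (n - k.choose 2) ::ₘ (Finset.Icc 1 (k - 1)).val ↔ _
    rw [Multiset.mem_cons, Finset.mem_val, Finset.mem_Icc, Multiset.mem_map]
    constructor
    · rintro (rfl | ⟨h2, h3⟩)
      · exact ⟨0, Multiset.mem_range.2 hk, by simp⟩
      · refine ⟨k - x, by rw [Multiset.mem_range]; omega, ?_⟩
        rw [if_neg (by omega)]
        omega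
    · rintro ⟨i, hi, rfl⟩
      rw [Multiset.mem_range] at hi
      split_ifs <;> omega

/-- Subtracting the staircase `k - i` makes the parts of `p` weakly decreasing and those of `τ_k`
equal to `Q + 1` or `Q`, where `Q` is the quotient. If the reduced part of `p` at index `j - 1` is
at least `Q + 1`, all earlier parts of `p` dominate termwise; otherwise all parts of `p` from there
on are dominated, and the equal totals reverse the comparison. -/
theorem tauMin_le (hk : 1 ≤ k) (hn : (k + 1).choose 2 ≤ n) {p : DisPartition n}
    (hp : p.len = k) : tauMin n k hk hn ≤ p := by
  obtain ⟨hl, ht⟩ := tauMin_part hk hn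
  refine le_of_len_eq hl hp fun j h1 hj => ?_
  by_cases hc : (n - (k + 1).choose 2) / k + 1 + (k - (j - 1)) ≤ p.part (j - 1)
  · refine Finset.sum_le_sum fun i hi => ?_
    rw [Finset.mem_range] at hi
    have h2 := p.part_add_le_part (i := i) (j := j - 1) (by omega) (by omega)
    rw [ht i (by omega)]
    split_ifs <;> omega
  · refine Finset.sum_range_le_sum_range_of_tail hj
      ((sum_part _ hl.le).trans (sum_part _ hp.le).symm) fun i hji hi => ?_
    have h2 := p.part_add_le_part (i := j - 1) (j := i) (by omega) (by omega)
    rw [ht i hi]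
    split_ifs <;> omega

/-- After its first part, `τ'_k` has the least parts that distinctness allows, so its tails are
smallest and its prefix sums largest. -/
theorem le_tauMax (hk : 1 ≤ k) (hn : (k + 1).choose 2 ≤ n) {p : DisPartition n}
    (hp : p.len = k) : p ≤ tauMax n k hk hn := by
  obtain ⟨hl, ht⟩ := tauMax_part hk hn
  refine le_of_len_eq hp hl fun j h1 hj => ?_
  refine Finset.sum_range_le_sum_range_of_tail hj
    ((sum_part _ hp.le).trans (sum_part _ hl.le).symm) fun i hji hi => ?_
  rw [ht i hi, if_neg (by omega), ← hp]
  exact p.len_sub_le_part i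

end DisPartition

/-! ### The Gale-Ryser theorem -/

/-- A family of finite sets with sizes majorizing `r` can be rearranged, keeping the number of
sets that contain each element, to a family of sets with sizes `r`. -/
theorem exists_family_card_eq_of_majorized {X : Type*} [DecidableEq X] (k : ℕ) (r : ℕ → ℕ)
    (hr : ∀ i j, i ≤ j → j < k → r j ≤ r i) (T : ℕ → Finset X)
    (hle : ∀ j ≤ k, ∑ i ∈ Finset.range j, r i ≤ ∑ i ∈ Finset.range j, (T i).card)
    (heq : ∑ i ∈ Finset.range k, r i = ∑ i ∈ Finset.range k, (T i).card) :
    ∃ T' : ℕ → Finset X, (∀ i < k, (T' i).card = r i) ∧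
      ∀ x, ((Finset.range k).filter fun i => x ∈ T' i).card =
        ((Finset.range k).filter fun i => x ∈ T i).card := by
  -- The measure is the total excess of the prefix sums; each round moves one element from one set
  -- to a later one.
  induction hd : ∑ j ∈ Finset.range k, (∑ i ∈ Finset.range j, (T i).card -
      ∑ i ∈ Finset.range j, r i) using Nat.strong_induction_on generalizing T with
  | _ d ih =>
  by_cases hall : ∀ i < k, (T i).card = r i
  · exact ⟨T, hall, fun _ => rfl⟩
  push Not at hall
  set a := Nat.find hall with ha
  obtain ⟨hak, hane⟩ := Nat.find_spec hall
  rw [← ha] at hak hane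
  have hmin : ∀ i < a, (T i).card = r i := by
    intro i hi
    by_contra hne
    exact Nat.find_min hall hi ⟨hi.trans hak, hne⟩
  have hsa : ∑ i ∈ Finset.range a, (T i).card = ∑ i ∈ Finset.range a, r i :=
    Finset.sum_congr rfl fun i hi => hmin i (Finset.mem_range.1 hi)
  have hra : r a < (T a).card := by
    have := hle (a + 1) hak
    rw [Finset.sum_range_succ, Finset.sum_range_succ, hsa] at this
    omega
  -- While `a` is the first index with a wrong size, `b` is the first later index after which the
  -- prefix sums agree again. Strictly in between there is slack.
  have hex : ∃ b, a < b ∧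
      ∑ i ∈ Finset.range (b + 1), (T i).card ≤ ∑ i ∈ Finset.range (b + 1), r i := by
    refine ⟨k - 1, ?_, ?_⟩
    · by_contra hlt
      have hka : k = a + 1 := by omega
      rw [hka, Finset.sum_range_succ, Finset.sum_range_succ, hsa] at heq
      omega
    · rw [Nat.sub_add_cancel (by omega)]
      exact heq.ge
  set b := Nat.find hex with hb
  obtain ⟨hab, hbs⟩ := Nat.find_spec hex
  rw [← hb] at hab hbs
  have hbk : b < k := by
    have h1 : b ≤ k - 1 := by
      refine Nat.find_min' hex ⟨?_, ?_⟩
      · by_contra hlt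
        have hka : k = a + 1 := by omega
        rw [hka, Finset.sum_range_succ, Finset.sum_range_succ, hsa] at heq
        omega
      · rw [Nat.sub_add_cancel (by omega)]
        exact heq.ge
    omega
  have hbetween : ∀ j, a < j → j ≤ b →
      ∑ i ∈ Finset.range j, r i < ∑ i ∈ Finset.range j, (T i).card := by
    intro j h1 h2
    by_cases hj : j = a + 1
    · subst hj
      rw [Finset.sum_range_succ, Finset.sum_range_succ, hsa]
      omega
    · by_contra! hlt
      refine Nat.find_min hex (m := j - 1) (by omega) ⟨by omega, ?_⟩
      rwa [Nat.sub_add_cancel (by omega)]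
  have hrb : (T b).card < r b := by
    have h1 := hbetween b hab le_rfl
    rw [Finset.sum_range_succ, Finset.sum_range_succ] at hbs
    omega
  -- Since `|T b| < r b ≤ r a < |T a|`, some `x` can move from `T a` to `T b`. This lowers exactly
  -- the prefix sums with `a < j ≤ b`, all of which have slack.
  have hlt : (T b).card < (T a).card := hrb.trans ((hr a b hab.le hbk).trans_lt hra)
  obtain ⟨x, hxa, hxb⟩ := Finset.exists_mem_notMem_of_card_lt_card hlt
  set U : ℕ → Finset X := fun i =>
    if i = a then (T a).erase x else if i = b then insert x (T b) else T i with hU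
  have hUa : U a = (T a).erase x := by simp [hU]
  have hUb : U b = insert x (T b) := by simp [hU, hab.ne']
  have hUo : ∀ i, i ≠ a → i ≠ b → U i = T i := by
    intro i h1 h2
    simp [hU, h1, h2]
  have hca : (U a).card + 1 = (T a).card := by
    rw [hUa]
    exact Finset.card_erase_add_one hxa
  have hcb : (U b).card = (T b).card + 1 := by
    rw [hUb]
    exact Finset.card_insert_of_notMem hxb
  have hpre1 : ∀ j, j ≤ a →
      ∑ i ∈ Finset.range j, (U i).card = ∑ i ∈ Finset.range j, (T i).card := by
    intro j hj
    refine Finset.sum_congr rfl fun i hi => ?_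
    rw [Finset.mem_range] at hi
    rw [hUo i (by omega) (by omega)]
  have hpre2 : ∀ j, a < j → j ≤ b →
      ∑ i ∈ Finset.range j, (U i).card + 1 = ∑ i ∈ Finset.range j, (T i).card := by
    intro j hj
    induction j, hj using Nat.le_induction with
    | base =>
      intro _
      rw [Finset.sum_range_succ, Finset.sum_range_succ, hpre1 a le_rfl]
      omega
    | succ j hj ih =>
      intro hjb
      rw [Finset.sum_range_succ, Finset.sum_range_succ _ j, ← ih (by omega),
        hUo j (by omega) (by omega)]
      omega
  have hpre3 : ∀ j, b < j →
      ∑ i ∈ Finset.range j, (U i).card = ∑ i ∈ Finset.range j, (T i).card := by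
    intro j hj
    induction j, hj using Nat.le_induction with
    | base =>
      rw [Finset.sum_range_succ, Finset.sum_range_succ, ← hpre2 b hab le_rfl]
      omega
    | succ j hj ih =>
      rw [Finset.sum_range_succ, Finset.sum_range_succ _ j, ih, hUo j (by omega) (by omega)]
  have hUle : ∀ j ≤ k, ∑ i ∈ Finset.range j, r i ≤ ∑ i ∈ Finset.range j, (U i).card := by
    intro j hj
    rcases le_or_gt j a with h1 | h1
    · rw [hpre1 j h1]
      exact hle j hj
    rcases le_or_gt j b with h2 | h2
    · have := hpre2 j h1 h2
      have := hbetween j h1 h2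
      omega
    · rw [hpre3 j h2]
      exact hle j hj
  have hdlt : ∑ j ∈ Finset.range k, (∑ i ∈ Finset.range j, (U i).card -
      ∑ i ∈ Finset.range j, r i) < d := by
    rw [← hd]
    refine Finset.sum_lt_sum (fun j _ => ?_) ⟨b, Finset.mem_range.2 hbk, ?_⟩
    · rcases le_or_gt j a with h1 | h1
      · rw [hpre1 j h1]
      rcases le_or_gt j b with h2 | h2
      · have := hpre2 j h1 h2
        omega
      · rw [hpre3 j h2]
    · have := hpre2 b hab le_rfl
      have := hbetween b hab le_rfl
      omega
  obtain ⟨T', h1, h2⟩ := ih _ hdlt U hUle (by rw [heq, hpre3 k hbk]) rfl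
  refine ⟨T', h1, fun y => (h2 y).trans ?_⟩
  by_cases hyx : y = x
  · subst hyx
    have hset : insert a ((Finset.range k).filter fun i => y ∈ U i) =
        insert b ((Finset.range k).filter fun i => y ∈ T i) := by
      ext i
      simp only [Finset.mem_insert, Finset.mem_filter, Finset.mem_range]
      by_cases hia : i = a
      · subst hia
        simp [hxa, hak]
      · by_cases hib : i = b
        · subst hib
          simp [hUb, hbk]
        · simp [hia, hib, hUo i hia hib]
    have hc := congrArg Finset.card hset
    rw [Finset.card_insert_of_notMem (by simp [hUa]), Finset.card_insert_of_notMem (by simp [hxb])]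
      at hc
    omega
  · congr 1
    refine Finset.filter_congr fun i _ => ?_
    by_cases hia : i = a
    · subst hia
      simp [hUa, hyx]
    · by_cases hib : i = b
      · subst hib
        simp [hUb, hyx]
      · rw [hUo i hia hib]

/-! ### Ferrers diagrams and their parts on both sides of the diagonal -/

namespace YoungDiagram

theorem lt_rowLen_iff_lt_colLen (F : YoungDiagram) {i j : ℕ} :
    j < F.rowLen i ↔ i < F.colLen j := by
  rw [← mem_iff_lt_rowLen, mem_iff_lt_colLen]

theorem rowLen_colLen_zero (F : YoungDiagram) : F.rowLen (F.colLen 0) = 0 := by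
  by_contra h
  have := F.lt_rowLen_iff_lt_colLen.1 (Nat.pos_of_ne_zero h)
  omega

theorem colLen_rowLen_zero (F : YoungDiagram) : F.colLen (F.rowLen 0) = 0 := by
  by_contra h
  have := F.lt_rowLen_iff_lt_colLen.2 (Nat.pos_of_ne_zero h)
  omega

theorem card_row_filter_le (F : YoungDiagram) (i : ℕ) :
    ((F.row i).filter fun c => c.1 ≤ c.2).card = F.rowLen i - i := by
  have : ((F.row i).filter fun c => c.1 ≤ c.2) = {i} ×ˢ Finset.Ico i (F.rowLen i) := by
    ext ⟨a, b⟩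
    simp only [row_eq_prod, Finset.mem_filter, Finset.mem_product, Finset.mem_singleton,
      Finset.mem_range, Finset.mem_Ico]
    omega
  simp [this]

theorem card_col_filter_lt (F : YoungDiagram) (j : ℕ) :
    ((F.col j).filter fun c => c.2 < c.1).card = F.colLen j - (j + 1) := by
  have : ((F.col j).filter fun c => c.2 < c.1) = Finset.Ico (j + 1) (F.colLen j) ×ˢ {j} := by
    ext ⟨a, b⟩
    simp only [col_eq_prod, Finset.mem_filter, Finset.mem_product, Finset.mem_singleton,
      Finset.mem_range, Finset.mem_Ico]
    omega
  simp [this]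

theorem alphaParts_eq_parts_iff (F : YoungDiagram) {n : ℕ} (p : DisPartition n) :
    alphaParts F = p.parts ↔ ∀ i, p.part i = F.rowLen i - i := by
  unfold alphaParts
  simp only [card_row_filter_le]
  refine p.filter_pos_map_range_eq_parts_iff (fun i => ?_) (by simp [rowLen_colLen_zero])
  have := F.rowLen_anti i (i + 1) (by omega)
  omega

theorem betaParts_eq_parts_iff (F : YoungDiagram) {n : ℕ} (q : DisPartition n) :
    betaParts F = q.parts ↔ ∀ j, q.part j = F.colLen j - (j + 1) := by
  unfold betaParts
  simp only [card_col_filter_lt]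
  refine q.filter_pos_map_range_eq_parts_iff (fun i => ?_) (by simp [colLen_rowLen_zero])
  have := F.colLen_anti i (i + 1) (by omega)
  omega

theorem colLen_eq_card_filter (F : YoungDiagram) (j : ℕ) :
    F.colLen j = ((Finset.range (F.colLen 0)).filter fun i => j < F.rowLen i).card := by
  have : ((Finset.range (F.colLen 0)).filter fun i => j < F.rowLen i) =
      Finset.range (F.colLen j) := by
    ext i
    have := F.colLen_anti 0 j (by omega)
    simp only [Finset.mem_filter, Finset.mem_range, lt_rowLen_iff_lt_colLen]
    omega
  rw [this, Finset.card_range]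

/-- The boxes in the first `k` columns are counted by columns and by rows. -/
theorem sum_range_colLen (F : YoungDiagram) (k : ℕ) :
    ∑ j ∈ Finset.range k, F.colLen j =
      ∑ i ∈ Finset.range (F.colLen 0), min k (F.rowLen i) := by
  rw [Finset.sum_congr rfl fun j _ => F.colLen_eq_card_filter j]
  simp only [Finset.card_filter]
  rw [Finset.sum_comm]
  refine Finset.sum_congr rfl fun i _ => ?_
  rw [← Finset.card_filter]
  have : ((Finset.range k).filter fun j => j < F.rowLen i) =
      Finset.range (min k (F.rowLen i)) := by
    ext j
    simp
  rw [this, Finset.card_range]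

/-- `F` has `α(F) = p` and `β(F) = q`, both with `k` parts. -/
structure HasParts (F : YoungDiagram) {n : ℕ} (p q : DisPartition n) (k : ℕ) : Prop where
  len_left : p.len = k
  len_right : q.len = k
  part_left : ∀ i, p.part i = F.rowLen i - i
  part_right : ∀ j, q.part j = F.colLen j - (j + 1)

namespace HasParts

variable {F : YoungDiagram} {n k : ℕ} {p q : DisPartition n}

theorem rowLen_eq (h : F.HasParts p q k) {i : ℕ} (hi : i < k) : F.rowLen i = p.part i + i := by
  have := h.part_left i
  have := p.part_pos (h.len_left ▸ hi)
  omega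

theorem colLen_eq (h : F.HasParts p q k) {j : ℕ} (hj : j < k) :
    F.colLen j = q.part j + (j + 1) := by
  have := h.part_right j
  have := q.part_pos (h.len_right ▸ hj)
  omega

theorem le_rowLen (h : F.HasParts p q k) {i : ℕ} (hi : i < k) : k ≤ F.rowLen i := by
  have h1 := p.len_sub_le_part i
  rw [h.len_left] at h1
  rw [h.rowLen_eq hi]
  omega

theorem rowLen_le (h : F.HasParts p q k) {i : ℕ} (hi : k ≤ i) : F.rowLen i ≤ k := by
  have h1 := h.part_left k
  rw [p.part_of_len_le h.len_left.le] at h1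
  exact (F.rowLen_anti k i hi).trans (by omega)

/-- The smallest part of `q` is at least 1, so column `k - 1` reaches below the `k × k` square and
the next row is full. -/
theorem rowLen_self (h : F.HasParts p q k) (hk : 1 ≤ k) : F.rowLen k = k := by
  refine le_antisymm (h.rowLen_le le_rfl) ?_
  have h1 := h.colLen_eq (j := k - 1) (by omega)
  have h2 := q.part_pos (i := k - 1) (by rw [h.len_right]; omega)
  have h3 := (F.lt_rowLen_iff_lt_colLen (i := k) (j := k - 1)).2 (by omega)
  omega

theorem lt_colLen_zero (h : F.HasParts p q k) (hk : 1 ≤ k) : k < F.colLen 0 := by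
  rw [← lt_rowLen_iff_lt_colLen, h.rowLen_self hk]
  exact hk

/-- Equality in the Erdős–Gallai inequality, with `k` moved to the left to avoid subtraction. The
first `k` columns contain exactly `k` boxes more than the first `k` rows, because `β` leaves out the
diagonal. -/
theorem sum_rowLen_add (h : F.HasParts p q k) (hk : 1 ≤ k) :
    ∑ i ∈ Finset.range k, F.rowLen i + k =
      k * k + ∑ i ∈ Finset.Ico k (F.colLen 0), F.rowLen i := by
  have h1 : ∑ i ∈ Finset.range k, F.rowLen i = n + ∑ i ∈ Finset.range k, i := by
    rw [← p.sum_part h.len_left.le, ← Finset.sum_add_distrib]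
    exact Finset.sum_congr rfl fun i hi => h.rowLen_eq (Finset.mem_range.1 hi)
  have h2 : ∑ j ∈ Finset.range k, F.colLen j = n + (∑ i ∈ Finset.range k, i + k) := by
    nth_rw 1 [← q.sum_part h.len_right.le]
    rw [Finset.sum_congr rfl fun j hj => h.colLen_eq (Finset.mem_range.1 hj)]
    simp [Finset.sum_add_distrib]
  have h3 := F.sum_range_colLen k
  rw [← Finset.sum_range_add_sum_Ico _ (h.lt_colLen_zero hk).le,
    Finset.sum_congr rfl fun i hi => min_eq_left (h.le_rowLen (Finset.mem_range.1 hi)),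
    Finset.sum_congr rfl fun i hi => min_eq_right (h.rowLen_le (Finset.mem_Ico.1 hi).1)] at h3
  simp only [Finset.sum_const, Finset.card_range, smul_eq_mul] at h3
  omega

end HasParts

end YoungDiagram

/-! ### Split graphs -/

/-- Equality of the multisets of values gives a bijection that matches the values. -/
theorem exists_equiv_fin_of_map_eq {V X : Type*} [Fintype V] {N : ℕ} {g : ℕ → X} {d : V → X}
    (h : (Multiset.range N).map g = Finset.univ.val.map d) :
    ∃ e : V ≃ Fin N, ∀ v, d v = g (e v) := by
  classical
  have hN : (Multiset.range N).map g = Finset.univ.val.map fun i : Fin N => g i := by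
    rw [Fin.univ_val_map, ← Multiset.coe_range, Multiset.map_coe]
    exact congrArg _ (List.ext_getElem (by simp) (by simp))
  -- Equal multiplicities make the fibres over each value equinumerous; the fibrewise bijections are
  -- then glued.
  have hcard : ∀ c, Nonempty ({v // d v = c} ≃ {i : Fin N // g i = c}) := by
    intro c
    rw [← Fintype.card_eq, Fintype.card_subtype, Fintype.card_subtype]
    have hc := congrArg (Multiset.count c) (h.symm.trans hN)
    rw [Multiset.count_map, Multiset.count_map] at hc
    simp only [eq_comm (a := c)] at hc
    exact hc
  exact ⟨Equiv.ofFiberEquiv fun c => (hcard c).some,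
    fun v => (Equiv.ofFiberEquiv_map (f := d) (g := fun i : Fin N => g i) _ v).symm⟩

namespace SimpleGraph

variable {V : Type*} {G : SimpleGraph V} {N k : ℕ}

/-- Equality in the Erdős–Gallai inequality forces a clique and a stable set. -/
theorem isClique_and_isIndepSet_of_sum_degree [Fintype V] [DecidableEq V]
    [DecidableRel G.Adj] (K : Finset V)
    (h : ∑ v ∈ K, G.degree v + K.card = K.card * K.card + ∑ v ∈ Kᶜ, G.degree v) :
    G.IsClique (K : Set V) ∧ G.IsIndepSet ((Kᶜ : Finset V) : Set V) := by
  have hdeg : ∀ v, G.degree v = (K.filter (G.Adj v)).card + (Kᶜ.filter (G.Adj v)).card := by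
    intro v
    rw [← card_neighborFinset_eq_degree, neighborFinset_eq_filter,
      ← Finset.card_filter_add_card_filter_not (s := Finset.univ.filter (G.Adj v)) (· ∈ K)]
    congr 2 <;> ext w <;> simp [and_comm]
  have hcross : ∑ v ∈ K, (Kᶜ.filter (G.Adj v)).card = ∑ v ∈ Kᶜ, (K.filter (G.Adj v)).card := by
    simp only [Finset.card_filter]
    rw [Finset.sum_comm]
    simp only [G.adj_comm]
  have hle : ∀ v ∈ K, (K.filter (G.Adj v)).card + 1 ≤ K.card := by
    intro v hv
    rw [← Finset.card_erase_add_one hv, Nat.add_le_add_iff_right]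
    refine Finset.card_le_card fun w hw => ?_
    rw [Finset.mem_filter] at hw
    exact Finset.mem_erase.2 ⟨hw.2.ne', hw.1⟩
  -- The edges between `K` and its complement cancel. Each term on the left is at most `K.card`, so
  -- the sum on the right must vanish and every bound is attained.
  have hsum : ∑ v ∈ K, ((K.filter (G.Adj v)).card + 1) =
      K.card * K.card + ∑ v ∈ Kᶜ, (Kᶜ.filter (G.Adj v)).card := by
    simp only [hdeg, Finset.sum_add_distrib, hcross] at h
    simp only [Finset.sum_add_distrib, Finset.sum_const, smul_eq_mul, mul_one]
    omega
  have hsum_le := Finset.sum_le_sum hle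
  have hzero : ∑ v ∈ Kᶜ, (Kᶜ.filter (G.Adj v)).card = 0 := by
    simp only [Finset.sum_const, smul_eq_mul] at hsum_le
    omega
  have heq : ∀ v ∈ K, (K.filter (G.Adj v)).card + 1 = K.card := by
    refine (Finset.sum_eq_sum_iff_of_le hle).1 ?_
    rw [hsum, hzero]
    simp
  constructor
  · intro v hv w hw hvw
    have hv : v ∈ K := hv
    have hw : w ∈ K := hw
    have hsub : K.filter (G.Adj v) ⊆ K.erase v := fun u hu => by
      rw [Finset.mem_filter] at hu
      exact Finset.mem_erase.2 ⟨hu.2.ne', hu.1⟩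
    have hset := Finset.eq_of_subset_of_card_le hsub
      (by have := heq v hv; have := Finset.card_erase_add_one hv; omega)
    have : w ∈ K.filter (G.Adj v) := by
      rw [hset]
      exact Finset.mem_erase.2 ⟨hvw.symm, hw⟩
    exact (Finset.mem_filter.1 this).2
  · intro v hv w hw _ hadj
    have h0 := Finset.sum_eq_zero_iff.1 hzero v hv
    rw [Finset.card_eq_zero] at h0
    have : w ∈ Kᶜ.filter (G.Adj v) := Finset.mem_filter.2 ⟨hw, hadj⟩
    rw [h0] at this
    exact absurd this (Finset.notMem_empty w)

/-- In the ordering `e` the vertices up to the one with index `k` form a clique, and those from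
that one on form a stable set. -/
structure IsSplitAt (G : SimpleGraph V) (e : V ≃ Fin N) (k : ℕ) : Prop where
  lt : k < N
  adj : ∀ u v, (e u : ℕ) ≤ k → (e v : ℕ) ≤ k → u ≠ v → G.Adj u v
  not_adj : ∀ u v, k ≤ (e u : ℕ) → k ≤ (e v : ℕ) → ¬ G.Adj u v

theorem IsSplitAt.chromaticNumber_eq {e : V ≃ Fin N} (h : G.IsSplitAt e k) :
    G.chromaticNumber = (k + 1 : ℕ) := by
  classical
  apply le_antisymm
  · refine Colorable.chromaticNumber_le ⟨Coloring.mk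
      -- All vertices of the stable set share colour `k`.
      (fun v => (⟨min (e v) k, by omega⟩ : Fin (k + 1))) fun {u v} huv heq => ?_⟩
    simp only [Fin.mk.injEq] at heq
    by_cases hk : k ≤ (e u : ℕ) ∧ k ≤ (e v : ℕ)
    · exact h.not_adj u v hk.1 hk.2 huv
    · exact huv.ne (e.injective (Fin.ext (by omega)))
  · have hcl : G.IsClique
        (((Finset.range (k + 1)).attach.image fun i =>
          e.symm ⟨i.1, by have := Finset.mem_range.1 i.2; have := h.lt; omega⟩ : Finset V) :
          Set V) := by
      intro u hu v hv huv
      simp only [Finset.coe_image, Set.mem_image, Finset.mem_coe, Finset.mem_attach, true_and,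
        Subtype.exists, Finset.mem_range] at hu hv
      obtain ⟨i, hi, rfl⟩ := hu
      obtain ⟨j, hj, rfl⟩ := hv
      exact h.adj _ _ (by simp; omega) (by simp; omega) huv
    have := hcl.card_le_chromaticNumber
    rwa [Finset.card_image_of_injective, Finset.card_attach, Finset.card_range] at this
    intro i j hij
    exact Subtype.ext (by simpa using congrArg (fun v => (e v : ℕ)) hij)

theorem IsSplitAt.chromaticNumber_compl_eq {e : V ≃ Fin N} (h : G.IsSplitAt e k) :
    Gᶜ.chromaticNumber = (N - k : ℕ) := by
  classical
  have hkN := h.lt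
  apply le_antisymm
  · refine Colorable.chromaticNumber_le ⟨Coloring.mk
      -- Truncated subtraction gives the whole clique colour 0.
      (fun v => (⟨e v - k, by omega⟩ : Fin (N - k))) fun {u v} huv heq => ?_⟩
    simp only [Fin.mk.injEq] at heq
    rw [compl_adj] at huv
    by_cases hk : (e u : ℕ) ≤ k ∧ (e v : ℕ) ≤ k
    · exact huv.2 (h.adj u v hk.1 hk.2 huv.1)
    · exact huv.1 (e.injective (Fin.ext (by omega)))
  · have hcl : Gᶜ.IsClique
        (((Finset.range (N - k)).attach.image fun i =>
          e.symm ⟨i.1 + k, by have := Finset.mem_range.1 i.2; omega⟩ : Finset V) : Set V) := by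
      intro u hu v hv huv
      simp only [Finset.coe_image, Set.mem_image, Finset.mem_coe, Finset.mem_attach, true_and,
        Subtype.exists, Finset.mem_range] at hu hv
      obtain ⟨i, hi, rfl⟩ := hu
      obtain ⟨j, hj, rfl⟩ := hv
      exact (compl_adj _ _ _).2 ⟨huv, h.not_adj _ _ (by simp) (by simp)⟩
    have := hcl.card_le_chromaticNumber
    rwa [Finset.card_image_of_injective, Finset.card_attach, Finset.card_range] at this
    intro i j hij
    exact Subtype.ext (by simpa using congrArg (fun v => (e v : ℕ)) hij)

theorem IsSplitAt.isNGGraph [Fintype V] {e : V ≃ Fin N} (h : G.IsSplitAt e k) : IsNGGraph G := by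
  have hkN := h.lt
  rw [IsNGGraph, h.chromaticNumber_eq, h.chromaticNumber_compl_eq, Fintype.card_congr e,
    Fintype.card_fin]
  norm_cast
  omega

end SimpleGraph

open Classical in
/-- A graph whose degree sequence has diagram parts `p` and `q` of equal length is split, with the
vertices of largest degree forming the clique. -/
theorem IsDegreeDiagram.exists_isSplitAt {V : Type*} [Fintype V] {G : SimpleGraph V}
    {F : YoungDiagram} (hG : IsDegreeDiagram G F) {n k : ℕ} {p q : DisPartition n}
    (h : F.HasParts p q k) (hk : 1 ≤ k) :
    ∃ e : V ≃ Fin (F.colLen 0), (∀ v, G.degree v = F.rowLen (e v)) ∧ G.IsSplitAt e k := by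
  have hN := h.lt_colLen_zero hk
  obtain ⟨e, he⟩ := exists_equiv_fin_of_map_eq (g := F.rowLen) hG
  refine ⟨e, he, ?_⟩
  set K : Finset V := Finset.univ.filter fun v => (e v : ℕ) < k with hK
  have hmemK : ∀ v, v ∈ K ↔ (e v : ℕ) < k := fun v => by simp [hK]
  have hsum : ∀ (f : ℕ → ℕ), ∑ v ∈ K, f (e v) = ∑ i ∈ Finset.range k, f i := by
    intro f
    refine Finset.sum_bij (fun v _ => (e v : ℕ)) (fun v hv => ?_) (fun u _ v _ huv => ?_)
      (fun i hi => ?_) fun _ _ => rfl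
    · exact Finset.mem_range.2 ((hmemK v).1 hv)
    · exact e.injective (Fin.ext huv)
    · rw [Finset.mem_range] at hi
      exact ⟨e.symm ⟨i, by omega⟩, by simpa [hmemK] using hi, by simp⟩
  have hsum' : ∑ v ∈ Kᶜ, F.rowLen (e v) = ∑ i ∈ Finset.Ico k (F.colLen 0), F.rowLen i := by
    refine Finset.sum_bij (fun v _ => (e v : ℕ)) (fun v hv => ?_) (fun u _ v _ huv => ?_)
      (fun i hi => ?_) fun _ _ => rfl
    · rw [Finset.mem_compl, hmemK] at hv
      exact Finset.mem_Ico.2 ⟨by omega, (e v).2⟩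
    · exact e.injective (Fin.ext huv)
    · rw [Finset.mem_Ico] at hi
      exact ⟨e.symm ⟨i, hi.2⟩, by simpa [hmemK] using hi.1, by simp⟩
  have hcard : K.card = k := by simpa using hsum fun _ => 1
  obtain ⟨hcl, hst⟩ := SimpleGraph.isClique_and_isIndepSet_of_sum_degree (G := G) K (by
    simp only [he]
    rw [hsum, hsum', hcard]
    exact h.sum_rowLen_add hk)
  have hnot : ∀ u v, k ≤ (e u : ℕ) → k ≤ (e v : ℕ) → ¬ G.Adj u v := by
    intro u v hu hv hadj
    exact hst (by simpa [hmemK] using hu) (by simpa [hmemK] using hv) hadj.ne hadj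
  -- The vertex with index `k` has degree `k` and all its neighbours in `K`, which has `k` elements.
  have htop : ∀ u v, (e u : ℕ) = k → (e v : ℕ) < k → G.Adj u v := by
    intro u v hu hv
    have hsub : G.neighborFinset u ⊆ K := by
      intro w hw
      rw [SimpleGraph.mem_neighborFinset] at hw
      rw [hmemK]
      by_contra hlt
      exact hnot u w hu.ge (by omega) hw
    have heq : G.neighborFinset u = K := Finset.eq_of_subset_of_card_le hsub (by
      rw [hcard, SimpleGraph.card_neighborFinset_eq_degree, he, hu, h.rowLen_self hk])
    rw [← SimpleGraph.mem_neighborFinset, heq, hmemK]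
    exact hv
  refine ⟨hN, fun u v hu hv huv => ?_, hnot⟩
  rcases hu.eq_or_lt with hu | hu
  · refine htop u v hu (lt_of_le_of_ne hv fun hv => huv (e.injective (Fin.ext (by omega))))
  · rcases hv.eq_or_lt with hv | hv
    · exact (htop v u hv hu).symm
    · exact hcl ((hmemK u).2 hu) ((hmemK v).2 hv) huv

/-! ### NG-1 and NG-2 in terms of the smallest parts -/

section

variable {V : Type*} [Fintype V] {G : SimpleGraph V} {F : YoungDiagram} {n k : ℕ}
  {p q : DisPartition n}

theorem IsDegreeDiagram.mem_setA_iff {e : V ≃ Fin (F.colLen 0)}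
    (he : ∀ v, open Classical in G.degree v = F.rowLen (e v)) (hs : G.IsSplitAt e k) (v : V) :
    v ∈ setA G ↔ F.rowLen (e v) = k := by
  rw [setA, Set.mem_ofPred_eq, hs.chromaticNumber_eq, he]
  norm_cast
  omega

/-- The vertex with index `k` always lies in `A_G`. The next one has degree `k` as well iff column
`k - 1` has length at least `k + 2`, that is, iff the smallest part of `q` is at least 2. -/
theorem IsDegreeDiagram.isNG1Graph_iff (hG : IsDegreeDiagram G F) (h : F.HasParts p q k)
    (hk : 1 ≤ k) : IsNG1Graph G ↔ q.part (k - 1) = 1 := by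
  obtain ⟨e, he, hs⟩ := hG.exists_isSplitAt h hk
  have hA := IsDegreeDiagram.mem_setA_iff he hs
  have hq := q.part_pos (i := k - 1) (by rw [h.len_right]; omega)
  have hcol := h.colLen_eq (j := k - 1) (by omega)
  constructor
  · rintro ⟨-, hcl⟩
    by_contra hne
    have h1 : k ≤ F.rowLen (k + 1) := by
      have := (F.lt_rowLen_iff_lt_colLen (i := k + 1) (j := k - 1)).2 (by omega)
      omega
    have h2 := h.rowLen_le (i := k + 1) (by omega)
    have h3 : k + 1 < F.colLen 0 := F.lt_rowLen_iff_lt_colLen.1 (by omega)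
    refine hs.not_adj (e.symm ⟨k, hs.lt⟩) (e.symm ⟨k + 1, h3⟩) (by simp) (by simp)
      (hcl ?_ ?_ (by simp))
    · rw [hA]
      simpa using h.rowLen_self hk
    · rw [hA]
      simpa using le_antisymm h2 h1
  · intro h1
    refine ⟨hs.isNGGraph, fun u hu v hv huv => ?_⟩
    rw [hA] at hu hv
    have hle : ∀ i, F.rowLen i = k → i ≤ k := by
      intro i hi
      have := (F.lt_rowLen_iff_lt_colLen (i := i) (j := k - 1)).1 (by omega)
      omega
    exact hs.adj u v (hle _ hu) (hle _ hv) huv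

/-- Among the first `k` vertices the least degree is that of index `k - 1`, namely the smallest part
of `p` plus `k - 1`; it equals `k` iff that part is 1. -/
theorem IsDegreeDiagram.isNG2Graph_iff (hG : IsDegreeDiagram G F) (h : F.HasParts p q k)
    (hk : 1 ≤ k) : IsNG2Graph G ↔ 2 ≤ p.part (k - 1) := by
  obtain ⟨e, he, hs⟩ := hG.exists_isSplitAt h hk
  have hA := IsDegreeDiagram.mem_setA_iff he hs
  have hp := p.part_pos (i := k - 1) (by rw [h.len_left]; omega)
  have hrow := h.rowLen_eq (i := k - 1) (by omega)
  have hlt := hs.lt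
  constructor
  · rintro ⟨-, hst⟩
    by_contra hne
    have hneq : e.symm ⟨k, hlt⟩ ≠ e.symm ⟨k - 1, by omega⟩ := by
      simp
      omega
    refine hst ?_ ?_ hneq (hs.adj _ _ (by simp) (by simp) hneq)
    · rw [hA]
      simpa using h.rowLen_self hk
    · rw [hA]
      simp only [Equiv.apply_symm_apply]
      omega
  · intro h2
    refine ⟨hs.isNGGraph, fun u hu v hv _ => ?_⟩
    rw [hA] at hu hv
    have hle : ∀ i, F.rowLen i = k → k ≤ i := by
      intro i hi
      by_contra! hik
      have := F.rowLen_anti i (k - 1) (by omega)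
      omega
    exact hs.not_adj u v (hle _ hu) (hle _ hv)

end

/-! ### Realization of blocks by graphs -/

/-- The first `k` rows are dictated by `p`, and the columns below them by `q`. Distinct parts make
the row and column lengths weakly decreasing, and the rows are long enough to cover those columns.
-/
theorem YoungDiagram.exists_hasParts {n k : ℕ} {p q : DisPartition n} (hp : p.len = k)
    (hq : q.len = k) : ∃ F : YoungDiagram, F.HasParts p q k := by
  have hpk : ∀ i, k ≤ p.part i + i := fun i => by have := p.len_sub_le_part i; omega
  have hqk : ∀ i, k ≤ q.part i + i := fun i => by have := q.len_sub_le_part i; omega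
  have hpa : ∀ i j, i ≤ j → j < k → p.part j + j ≤ p.part i + i := fun i j hij hj => by
    have := p.part_add_le_part hij (by omega); omega
  have hqa : ∀ i j, i ≤ j → j < k → q.part j + j ≤ q.part i + i := fun i j hij hj => by
    have := q.part_add_le_part hij (by omega); omega
  set P : ℕ × ℕ → Prop := fun c =>
    (c.1 < k ∧ c.2 < p.part c.1 + c.1) ∨ (c.2 < k ∧ k ≤ c.1 ∧ c.1 < q.part c.2 + (c.2 + 1)) with hP
  have hlow : ∀ i j i' j', i' ≤ i → j' ≤ j → P (i, j) → P (i', j') := by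
    rintro i j i' j' hi hj (⟨h1, h2⟩ | ⟨h1, h2, h3⟩)
    · have := hpa i' i hi h1
      exact Or.inl ⟨by omega, by simp only at h2 ⊢; omega⟩
    · simp only at h1 h2 h3
      have h4 := hqa j' j hj h1
      have h5 := hpk i'
      by_cases hik : i' < k
      · exact Or.inl ⟨hik, by simp only; omega⟩
      · exact Or.inr ⟨by simp only; omega, by simp only; omega, by simp only; omega⟩
  have hbdp : ∀ i, p.part i + i ≤ n + i := fun i => by
    have h1 := p.prefixSum_le (i + 1)
    rw [DisPartition.prefixSum_eq_sum, Finset.sum_range_succ] at h1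
    omega
  have hbdq : ∀ i, q.part i + i ≤ n + i := fun i => by
    have h1 := q.prefixSum_le (i + 1)
    rw [DisPartition.prefixSum_eq_sum, Finset.sum_range_succ] at h1
    omega
  classical
  let F : YoungDiagram :=
    ⟨((Finset.range (n + k + 1)) ×ˢ (Finset.range (n + k + 1))).filter P, by
      rintro ⟨i, j⟩ ⟨i', j'⟩ hle hmem
      obtain ⟨hi, hj⟩ := Prod.mk_le_mk.1 hle
      simp only [Finset.coe_filter, Finset.mem_product, Finset.mem_range, Set.mem_ofPred_eq]
        at hmem ⊢
      exact ⟨⟨by omega, by omega⟩, hlow _ _ _ _ hi hj hmem.2⟩⟩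
  have hmem : ∀ i j, (i, j) ∈ F ↔ P (i, j) := by
    intro i j
    change (i, j) ∈ Finset.filter _ _ ↔ _
    rw [Finset.mem_filter, Finset.mem_product, Finset.mem_range, Finset.mem_range]
    refine and_iff_right_of_imp ?_
    have h1 := hbdp i
    have h2 := hbdq j
    rintro (⟨h3, h4⟩ | ⟨h3, h4, h5⟩)
    · simp only at h3 h4 ⊢
      omega
    · simp only at h3 h4 h5 ⊢
      omega
  have hrow : ∀ i j, j < F.rowLen i ↔ P (i, j) := fun i j => by
    rw [← YoungDiagram.mem_iff_lt_rowLen, hmem]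
  have hcol : ∀ i j, i < F.colLen j ↔ P (i, j) := fun i j => by
    rw [← YoungDiagram.mem_iff_lt_colLen, hmem]
  refine ⟨F, hp, hq, fun i => ?_, fun j => ?_⟩
  · by_cases hi : i < k
    · have : F.rowLen i = p.part i + i := by
        refine eq_of_forall_lt_iff fun j => ?_
        rw [hrow]
        simp only [hP]
        omega
      omega
    · rw [p.part_of_len_le (by omega)]
      have h1 : F.rowLen i ≤ k := by
        by_contra! h1
        have := (hrow i k).1 h1
        simp only [hP] at this
        omega
      omega
  · by_cases hj : j < k
    · have : F.colLen j = q.part j + (j + 1) := by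
        refine eq_of_forall_lt_iff fun i => ?_
        rw [hcol]
        have h1 := hpk i
        have h2 := hqk j
        simp only [hP]
        omega
      omega
    · rw [q.part_of_len_le (by omega)]
      have h1 : F.colLen j ≤ k := by
        by_contra! h1
        have := (hcol k j).1 h1
        simp only [hP] at this
        omega
      omega

/-- The graph on `Fin N` whose first `k` vertices form a clique, whose other vertices form a
stable set, and in which the vertex `i < k` is adjacent to the vertices `≥ k` that lie in `T i`. -/
def splitGraph (N k : ℕ) (T : ℕ → Finset ℕ) : SimpleGraph (Fin N) where
  Adj u v := u ≠ v ∧ ((u.1 < k ∧ v.1 < k) ∨ (u.1 < k ∧ k ≤ v.1 ∧ v.1 ∈ T u) ∨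
    (v.1 < k ∧ k ≤ u.1 ∧ u.1 ∈ T v))
  symm := ⟨fun u v h => ⟨h.1.symm, by tauto⟩⟩
  loopless := ⟨fun _ h => h.1 rfl⟩

theorem splitGraph_adj {N k : ℕ} {T : ℕ → Finset ℕ} {u v : Fin N} :
    (splitGraph N k T).Adj u v ↔ u ≠ v ∧ ((u.1 < k ∧ v.1 < k) ∨ (u.1 < k ∧ k ≤ v.1 ∧ v.1 ∈ T u) ∨
      (v.1 < k ∧ k ≤ u.1 ∧ u.1 ∈ T v)) :=
  Iff.rfl

open Classical in
theorem splitGraph_degree {N k : ℕ} (T : ℕ → Finset ℕ) (hkN : k ≤ N)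
    (hT : ∀ i < k, T i ⊆ Finset.Ico k N) (v : Fin N) :
    (splitGraph N k T).degree v = if v.1 < k then k - 1 + (T v).card else
      ((Finset.range k).filter fun i => v.1 ∈ T i).card := by
  rw [← SimpleGraph.card_neighborFinset_eq_degree, ← Finset.card_map Fin.valEmbedding]
  split_ifs with hv
  · have hdisj : Disjoint ((Finset.range k).erase v) (T v) := by
      rw [Finset.disjoint_left]
      intro i hi hi'
      have h1 := Finset.mem_Ico.1 (hT v hv hi')
      have h2 := Finset.mem_range.1 (Finset.mem_of_mem_erase hi)
      omega
    have hcard : ((Finset.range k).erase v).card = k - 1 := by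
      rw [Finset.card_erase_of_mem (Finset.mem_range.2 hv), Finset.card_range]
    rw [← hcard, ← Finset.card_union_of_disjoint hdisj]
    congr 1
    ext i
    simp only [Finset.mem_map, SimpleGraph.mem_neighborFinset, splitGraph_adj,
      Fin.valEmbedding_apply, Finset.mem_union, Finset.mem_erase, Finset.mem_range]
    constructor
    · rintro ⟨u, ⟨h1, h2⟩, rfl⟩
      have : (u : ℕ) ≠ v := fun h => h1 (Fin.ext h.symm)
      rcases h2 with h2 | h2 | h2
      · exact Or.inl ⟨this, h2.2⟩
      · exact Or.inr h2.2.2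
      · omega
    · rintro (⟨h1, h2⟩ | h1)
      · exact ⟨⟨i, by omega⟩, ⟨fun h => h1 (by rw [h]), Or.inl ⟨hv, h2⟩⟩, rfl⟩
      · have h2 := Finset.mem_Ico.1 (hT v hv h1)
        exact ⟨⟨i, h2.2⟩, ⟨fun h => by rw [h] at hv; simp only at hv; omega,
          Or.inr (Or.inl ⟨hv, h2.1, h1⟩)⟩, rfl⟩
  · congr 1
    ext i
    simp only [Finset.mem_map, SimpleGraph.mem_neighborFinset, Finset.mem_filter, splitGraph_adj,
      Fin.valEmbedding_apply, Finset.mem_range]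
    constructor
    · rintro ⟨u, ⟨h1, h2⟩, rfl⟩
      rcases h2 with h2 | h2 | h2
      · omega
      · omega
      · exact ⟨h2.1, h2.2.2⟩
    · rintro ⟨h1, h2⟩
      exact ⟨⟨i, by omega⟩, ⟨fun h => by rw [h] at hv; simp only at hv; omega,
        Or.inr (Or.inr ⟨h1, by omega, h2⟩)⟩, rfl⟩

/-- Clique vertex `i` needs `p.part i + i + 1 - k` neighbours in the stable set, and column `i` has
`q.part i + i + 1 - k` boxes below row `k - 1`. The shifts agree, so `p ≤ q` is the majorization
that lets the column sets be rearranged. -/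
theorem YoungDiagram.HasParts.exists_isDegreeDiagram {F : YoungDiagram} {n k : ℕ}
    {p q : DisPartition n} (h : F.HasParts p q k) (hk : 1 ≤ k) (hpq : p ≤ q) :
    ∃ G : SimpleGraph (Fin (F.colLen 0)), IsDegreeDiagram G F := by
  have hN := h.lt_colLen_zero hk
  have hcolk : ∀ i < k, k + 1 ≤ F.colLen i := by
    intro i hi
    have := q.len_sub_le_part i
    rw [h.len_right] at this
    rw [h.colLen_eq hi]
    omega
  have hr : ∀ j ≤ k, ∑ i ∈ Finset.range j, (F.rowLen i + 1 - k) + j * k =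
      ∑ i ∈ Finset.range j, p.part i + ∑ i ∈ Finset.range j, (i + 1) := by
    intro j hj
    have : j * k = ∑ i ∈ Finset.range j, k := by simp
    rw [this, ← Finset.sum_add_distrib, ← Finset.sum_add_distrib]
    refine Finset.sum_congr rfl fun i hi => ?_
    rw [Finset.mem_range] at hi
    have h1 := h.rowLen_eq (i := i) (by omega)
    have h2 := h.le_rowLen (i := i) (by omega)
    omega
  have hc : ∀ j ≤ k, ∑ i ∈ Finset.range j, (Finset.Ico k (F.colLen i)).card + j * k =
      ∑ i ∈ Finset.range j, q.part i + ∑ i ∈ Finset.range j, (i + 1) := by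
    intro j hj
    have : j * k = ∑ i ∈ Finset.range j, k := by simp
    rw [this, ← Finset.sum_add_distrib, ← Finset.sum_add_distrib]
    refine Finset.sum_congr rfl fun i hi => ?_
    rw [Finset.mem_range] at hi
    have h1 := h.colLen_eq (j := i) (by omega)
    have h2 := hcolk i (by omega)
    rw [Nat.card_Ico]
    omega
  obtain ⟨T, hT1, hT2⟩ := exists_family_card_eq_of_majorized k (fun i => F.rowLen i + 1 - k)
    (fun i j hij _ => by have := F.rowLen_anti i j hij; omega)
    (fun i => Finset.Ico k (F.colLen i))
    (fun j hj => by
      have h1 := hr j hj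
      have h2 := hc j hj
      have h3 := (DisPartition.le_iff_sum_part p q).1 hpq j
      omega)
    (by
      have h1 := hr k le_rfl
      have h2 := hc k le_rfl
      rw [p.sum_part h.len_left.le] at h1
      rw [q.sum_part h.len_right.le] at h2
      omega)
  -- An element of some new set also lay in some old one, since the membership counts are unchanged.
  have hTsub : ∀ i < k, T i ⊆ Finset.Ico k (F.colLen 0) := by
    intro i hi x hx
    have h1 : 0 < ((Finset.range k).filter fun i => x ∈ T i).card :=
      Finset.card_pos.2 ⟨i, Finset.mem_filter.2 ⟨Finset.mem_range.2 hi, hx⟩⟩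
    rw [hT2] at h1
    obtain ⟨j, hj⟩ := Finset.card_pos.1 h1
    have h2 := Finset.mem_Ico.1 (Finset.mem_filter.1 hj).2
    exact Finset.mem_Ico.2 ⟨h2.1, h2.2.trans_le (F.colLen_anti 0 j (Nat.zero_le j))⟩
  have hlow : ∀ s, k ≤ s → ((Finset.range k).filter fun i => s ∈ T i).card = F.rowLen s := by
    intro s hs
    have : ((Finset.range k).filter fun i => s ∈ Finset.Ico k (F.colLen i)) =
        Finset.range (F.rowLen s) := by
      ext i
      have := h.rowLen_le hs
      rw [Finset.mem_filter, Finset.mem_range, Finset.mem_range, Finset.mem_Ico,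
        ← F.lt_rowLen_iff_lt_colLen]
      omega
    rw [hT2, this, Finset.card_range]
  refine ⟨splitGraph (F.colLen 0) k T, ?_⟩
  rw [IsDegreeDiagram, Fin.univ_val_map]
  refine congrArg _ (List.ext_getElem (by simp) fun i h1 h2 => ?_)
  rw [YoungDiagram.get_rowLens, List.getElem_ofFn, splitGraph_degree T hN.le hTsub]
  split_ifs with hi
  · simp only at hi ⊢
    have := h.le_rowLen hi
    rw [hT1 i hi]
    omega
  · exact (hlow i (by simpa using hi)).symm

/-! ### The amphoras -/

namespace SBlock

variable {n k : ℕ}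

theorem IsBlockOf.exists_hasParts {V : Type*} [Fintype V] {G : SimpleGraph V} {b : SBlock n}
    (h : b.IsBlockOf G) (hb : b ∈ amphoraA n k) :
    ∃ F : YoungDiagram, IsDegreeDiagram G F ∧ F.HasParts b.α b.β k := by
  obtain ⟨F, hG, h1, h2⟩ := h
  exact ⟨F, hG, hb.1, hb.2, (F.alphaParts_eq_parts_iff _).1 h1, (F.betaParts_eq_parts_iff _).1 h2⟩

theorem exists_isBlockOf (hk : 1 ≤ k) {b : SBlock n} (hb : b ∈ amphoraA n k) :
    ∃ (r : ℕ) (G : SimpleGraph (Fin r)), b.IsBlockOf G := by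
  obtain ⟨F, hF⟩ := YoungDiagram.exists_hasParts hb.1 hb.2
  obtain ⟨G, hG⟩ := hF.exists_isDegreeDiagram hk b.maj
  exact ⟨_, G, F, hG, (F.alphaParts_eq_parts_iff _).2 hF.part_left,
    (F.betaParts_eq_parts_iff _).2 hF.part_right⟩

/-- A block with `k` parts on both sides is NG-1 when the smallest part of `β` is `1`. -/
theorem isNG1_iff (hk : 1 ≤ k) {b : SBlock n} (hb : b ∈ amphoraA n k) :
    b.IsNG1 ↔ b.β.part (k - 1) = 1 := by
  constructor
  · rintro ⟨r, G, hG, hbG⟩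
    obtain ⟨F, hF, hparts⟩ := hbG.exists_hasParts hb
    exact (hF.isNG1Graph_iff hparts hk).1 hG
  · intro h
    obtain ⟨r, G, hbG⟩ := exists_isBlockOf hk hb
    obtain ⟨F, hF, hparts⟩ := hbG.exists_hasParts hb
    exact ⟨r, G, (hF.isNG1Graph_iff hparts hk).2 h, hbG⟩

/-- A block with `k` parts on both sides is NG-2 when the smallest part of `α` is at least `2`. -/
theorem isNG2_iff (hk : 1 ≤ k) {b : SBlock n} (hb : b ∈ amphoraA n k) :
    b.IsNG2 ↔ 2 ≤ b.α.part (k - 1) := by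
  constructor
  · rintro ⟨r, G, hG, hbG⟩
    obtain ⟨F, hF, hparts⟩ := hbG.exists_hasParts hb
    exact (hF.isNG2Graph_iff hparts hk).1 hG
  · intro h
    obtain ⟨r, G, hbG⟩ := exists_isBlockOf hk hb
    obtain ⟨F, hF, hparts⟩ := hbG.exists_hasParts hb
    exact ⟨r, G, (hF.isNG2Graph_iff hparts hk).2 h, hbG⟩

theorem diag_mem_amphoraA {γ : DisPartition n} (h : γ.len = k) : diag γ ∈ amphoraA n k := ⟨h, h⟩

/-- The two components are ordered in opposite directions, so comparability of diagonal blocks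
forces equality. -/
theorem isAntichain_maxBlocks : IsAntichain (· ≤ ·) (maxBlocks n k) := by
  rintro _ ⟨γ, -, rfl⟩ _ ⟨δ, -, rfl⟩ hne hle
  exact hne (congrArg diag (le_antisymm hle.1 hle.2))

/-- The least block with `k` parts on both sides. -/
def tau (n k : ℕ) (hk : 1 ≤ k) (hn : (k + 1).choose 2 ≤ n) : SBlock n where
  α := DisPartition.tauMin n k hk hn
  β := DisPartition.tauMax n k hk hn
  maj := DisPartition.tauMin_le hk hn (DisPartition.tauMax_part hk hn).1
  len_eq := Or.inl
    ((DisPartition.tauMin_part hk hn).1.trans (DisPartition.tauMax_part hk hn).1.symm)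

theorem tau_le (hk : 1 ≤ k) (hn : (k + 1).choose 2 ≤ n) {b : SBlock n}
    (hb : b ∈ amphoraA n k) : tau n k hk hn ≤ b :=
  ⟨DisPartition.tauMin_le hk hn hb.1, DisPartition.le_tauMax hk hn hb.2⟩

/-- Length reverses majorization, so the bounds below and above pin both lengths to `k`. -/
theorem mem_amphoraA_of_le (hk : 1 ≤ k) (hn : (k + 1).choose 2 ≤ n) {b m : SBlock n}
    (hx : tau n k hk hn ≤ b) (hm : m ∈ maxBlocks n k) (hbm : b ≤ m) : b ∈ amphoraA n k := by
  obtain ⟨γ, hγ, rfl⟩ := hm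
  have h1 := DisPartition.len_le_of_le hx.1
  have h2 := DisPartition.len_le_of_le hx.2
  have h3 : γ.len ≤ b.α.len := DisPartition.len_le_of_le hbm.1
  have h4 : b.β.len ≤ γ.len := DisPartition.len_le_of_le hbm.2
  have h5 : (tau n k hk hn).α.len = k := (DisPartition.tauMin_part hk hn).1
  have h6 : (tau n k hk hn).β.len = k := (DisPartition.tauMax_part hk hn).1
  exact ⟨by omega, by omega⟩

theorem NG1_eq (hk : 1 ≤ k) (hn : (k + 1).choose 2 ≤ n) :
    NG1 n k = {b | tau n k hk hn ≤ b ∧ ∃ m ∈ maxBlocks n k, m.IsNG1 ∧ b ≤ m} := by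
  ext b
  constructor
  · rintro ⟨hb, hng⟩
    refine ⟨tau_le hk hn hb, diag b.β, ⟨b.β, hb.2, rfl⟩, ?_, b.maj, le_rfl⟩
    rw [isNG1_iff hk hb] at hng
    exact (isNG1_iff hk (diag_mem_amphoraA hb.2)).2 hng
  · rintro ⟨hx, m, hm, hng, hbm⟩
    have hb := mem_amphoraA_of_le hk hn hx hm hbm
    refine ⟨hb, (isNG1_iff hk hb).2 ?_⟩
    obtain ⟨γ, hγ, rfl⟩ := hm
    have h1 : γ.part (k - 1) = 1 := (isNG1_iff hk (diag_mem_amphoraA hγ)).1 hng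
    have h2 : b.β.part (k - 1) ≤ γ.part (k - 1) :=
      DisPartition.last_part_le (by omega) (by have := hb.2; omega) hbm.2
    have h3 := b.β.part_pos (i := k - 1) (by have := hb.2; omega)
    omega

theorem NG2_eq (hk : 1 ≤ k) (hn : (k + 1).choose 2 ≤ n) :
    NG2 n k = {b | tau n k hk hn ≤ b ∧ ∃ m ∈ maxBlocks n k, m.IsNG2 ∧ b ≤ m} := by
  ext b
  constructor
  · rintro ⟨hb, hng⟩
    refine ⟨tau_le hk hn hb, diag b.α, ⟨b.α, hb.1, rfl⟩, ?_, le_rfl, b.maj⟩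
    rw [isNG2_iff hk hb] at hng
    exact (isNG2_iff hk (diag_mem_amphoraA hb.1)).2 hng
  · rintro ⟨hx, m, hm, hng, hbm⟩
    have hb := mem_amphoraA_of_le hk hn hx hm hbm
    refine ⟨hb, (isNG2_iff hk hb).2 ?_⟩
    obtain ⟨γ, hγ, rfl⟩ := hm
    have h1 : 2 ≤ γ.part (k - 1) := (isNG2_iff hk (diag_mem_amphoraA hγ)).1 hng
    have h2 : γ.part (k - 1) ≤ b.α.part (k - 1) :=
      DisPartition.last_part_le (by have := hb.1; omega) (by omega) hbm.1
    omega

theorem isAmphora_of_eq (hk : 1 ≤ k) (hn : (k + 1).choose 2 ≤ n) {S : Set (SBlock n)}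
    {Q : SBlock n → Prop}
    (hS : S = {b | tau n k hk hn ≤ b ∧ ∃ m ∈ maxBlocks n k, Q m ∧ b ≤ m}) : IsAmphora S := by
  refine ⟨{m | m ∈ maxBlocks n k ∧ Q m}, tau n k hk hn,
    isAntichain_maxBlocks.subset fun m hm => hm.1, ?_, ?_⟩
  · rintro _ ⟨⟨γ, hγ, rfl⟩, -⟩
    exact tau_le hk hn (diag_mem_amphoraA hγ)
  · simp only [hS, Set.mem_ofPred_eq, and_assoc]

end SBlock

theorem theorem4p18 (n k : ℕ) (hk : 1 ≤ k) (hn : (k + 1).choose 2 ≤ n) :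
    IsAmphora (SBlock.NG1 n k) ∧ IsAmphora (SBlock.NG2 n k) ∧
    ∃ x : SBlock n,
      x.α = DisPartition.tauMin n k hk hn ∧ x.β = DisPartition.tauMax n k hk hn ∧
      SBlock.NG1 n k = {b | x ≤ b ∧ ∃ m ∈ SBlock.maxBlocks n k, m.IsNG1 ∧ b ≤ m} ∧
      SBlock.NG2 n k = {b | x ≤ b ∧ ∃ m ∈ SBlock.maxBlocks n k, m.IsNG2 ∧ b ≤ m} :=
  ⟨SBlock.isAmphora_of_eq hk hn (SBlock.NG1_eq hk hn),
    SBlock.isAmphora_of_eq hk hn (SBlock.NG2_eq hk hn),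
    SBlock.tau n k hk hn, rfl, rfl, SBlock.NG1_eq hk hn, SBlock.NG2_eq hk hn⟩
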